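/- Let $u$ be the Hastings–McLeod solution of the second Painlevé equation with parameter $0$: $u:\mathbb R\to\mathbb R$ is of class $C^2$, $u''(s)=2u(s)^3+s\,u(s)$ for all $s$, and $u(s)\sim \mathrm{Ai}(s)$ as $s\to+\infty$. Put $s=-2^{-1/3}t$ and $D=\{t\in\mathbb R: u(-2^{-1/3}t)\neq 0\}$. Starting from the Gambier (folding) transform of $u$ with $\epsilon=-1$, $$q_0(t)=-2^{-1/3}\,\frac{u'(s)}{u(s)},\qquad p_0(t)=\dot q_0(t)+q_0(t)^2+\tfrac12 t,\qquad \alpha_1=0,$$ apply twice the Schlesinger (Bäcklund) shift $T_2:\alpha_1\mapsto\alpha_1+1$, $$T_2(\alpha_1;q,p)=\Bigl(\alpha_1+1;\ -q-\frac{\alpha_1}{p},\ \ t-p+2\bigl(q+\tfrac{\alpha_1}{p}\bigr)^2\Bigr),$$ to obtain $(1;q_1,p_1)$ and $(2;q_2,p_2)$. Then: 1. For every $a\in\mathbb R$, $u$ has only finitely many zeros in $[a,\infty)$ (if any), and $p_0$ and $p_1$ do not vanish on $D$, so that the construction is well defined on $D$. 2. On $D$ one has $2^{1/3}u(s)^2=\dot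 q_0+q_0^2+\tfrac12t=p_0$. For $j=0,1,2$ the pair $(q_j,p_j)$ satisfies on $D$ the Hamilton equations $\dot q=p-q^2-\tfrac12t$, $\dot p=2qp+\alpha_1$ with $\alpha_1=j$. In particular $\ddot q_2=2q_2^3+t\,q_2+\tfrac32$ on $D$. 3. The Hamiltonian $-\tfrac12(2q_2^2-p_2+t)p_2-2q_2$ extends from $D$ to a function $H\in C^2(\mathbb R)$ that satisfies on all of $\mathbb R$ the $\sigma$-form of PII with $\alpha_1=2$, $$(\ddot H)^2+4(\dot H)^3+2\dot H\,(t\dot H-H)-\tfrac14\alpha_1^2=0,$$ and the boundary condition $H(-y)\sim\sqrt{2y}+\frac1y$ as $y\to\infty$, in the sense of a two-term asymptotic expansion: $H(-y)=\sqrt{2y}+\frac1y+o\bigl(\frac1y\bigr)$. -/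

import Mathlib

open Filter Topology Asymptotics

noncomputable section

/-- The Airy function `Ai` on the real line, by its contour integral
`Ai(x) = (1/(2πi)) ∫ exp(z³/3 - x z) dz` from `∞ e^{-iπ/3}` to `∞ e^{iπ/3}` along the two rays
`z = r e^{±iπ/3}`, `r > 0` (on which `z³ = -r³`). The two rays contribute complex conjugates, which
leaves `1/π` times the imaginary part of the integral along the upper one. -/
def airyAi (x : ℝ) : ℝ :=
  (1 / Real.pi) * (∫ r in Set.Ioi (0 : ℝ),
    Complex.exp (-(r : ℂ) ^ 3 / 3 - x * (r * Complex.exp (Complex.I * Real.pi / 3)))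
      * Complex.exp (Complex.I * Real.pi / 3)).im

/-- `u` is the Hastings–McLeod solution: a solution on the real line of the second Painlevé equation
with `α = 0`, asymptotic to `Ai(s)` as `s → +∞`. -/
structure IsHastingsMcLeod (u : ℝ → ℝ) : Prop where
  contDiff : ContDiff ℝ 2 u
  ode : ∀ s : ℝ, deriv (deriv u) s = 2 * u s ^ 3 + s * u s
  asymp : u ~[atTop] airyAi

/-- A parameter `α₁` with a pair of canonical variables `q`, `p` of the Hamiltonian system for
the second Painlevé equation. -/
structure PIIState where
  α₁ : ℝ
  q : ℝ → ℝ
  p : ℝ → ℝ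

namespace PIIState

/-- Hamilton's equations `q' = p - q² - t/2`, `p' = 2qp + α₁` at every point of `D`. -/
def SolvesOn (x : PIIState) (D : Set ℝ) : Prop :=
  ∀ t ∈ D, HasDerivAt x.q (x.p t - x.q t ^ 2 - t / 2) t ∧
    HasDerivAt x.p (2 * x.q t * x.p t + x.α₁) t

/-- The Hamiltonian `H = -(2q² - p + t)p/2 - α₁ q`. -/
def H (x : PIIState) (t : ℝ) : ℝ :=
  -(1 / 2) * (2 * x.q t ^ 2 - x.p t + t) * x.p t - x.α₁ * x.q t

/-- The Schlesinger (Bäcklund) shift `T₂ : α₁ ↦ α₁ + 1`. -/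
def T₂ (x : PIIState) : PIIState where
  α₁ := x.α₁ + 1
  q := fun t => -x.q t - x.α₁ / x.p t
  p := fun t => t - x.p t + 2 * (x.q t + x.α₁ / x.p t) ^ 2

end PIIState

/-- The argument `s = -2^{-1/3} t`, that is, `t = -2^{1/3} s`. -/
def gambierArg (t : ℝ) : ℝ := -(2 : ℝ) ^ (-(1 / 3) : ℝ) * t

/-- The transcendent `q(t; ε/2) = ε 2^{-1/3} u'(s) / u(s)`, `t = -2^{1/3} s`, that the Gambier
transformation makes of a solution `u` with parameter `α = 0`. -/
def gambierQ (ε : ℝ) (u : ℝ → ℝ) (t : ℝ) : ℝ :=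
  ε * (2 : ℝ) ^ (-(1 / 3) : ℝ) * (deriv u (gambierArg t) / u (gambierArg t))

/-- The Gambier transform as canonical variables: `α₁ = α + 1/2` with `α = ε/2`, and `p` is the
momentum `p = q' + q² + t/2` of `q`. -/
def gambier (ε : ℝ) (u : ℝ → ℝ) : PIIState where
  α₁ := ε / 2 + 1 / 2
  q := gambierQ ε u
  p := fun t => deriv (gambierQ ε u) t + gambierQ ε u t ^ 2 + t / 2

/-- `H` is a (twice continuously differentiable) solution on the real line of the
Jimbo–Miwa–Okamoto `σ`-form of the second Painlevé equation with parameter `α₁`. -/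
def IsSigmaPII (α₁ : ℝ) (H : ℝ → ℝ) : Prop :=
  ContDiff ℝ 2 H ∧ ∀ t : ℝ,
    deriv (deriv H) t ^ 2 + 4 * deriv H t ^ 3 + 2 * deriv H t * (t * deriv H t - H t)
      - (1 / 4) * α₁ ^ 2 = 0

end

/-! ### The Airy function -/

/-! Everything is governed by the energy h = u'² - s u² - u⁴ (`piiEnergy`), which satisfies h' =
-u². The construction gives p₀ = 2^{1/3} u² and p₁ = 2^{1/3} h / u², and the Hamiltonian after two
shifts is 2^{-1/3} (u² / h - h), which is `gambierSigma`. If h > 0 on all of ℝ, then the shifts are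
defined wherever u ≠ 0, the zeros of u are simple, and the closed formula extends the Hamiltonian
across them. Its σ-form is then an algebraic identity modulo the relation defining h, so no limit at
the zeros of u is needed.

Only two facts about Ai enter: it is bounded on [0, ∞), and it does not vanish identically near +∞.
For s ≥ 0 the function u² is convex, since (u²)'' = 2u'² + 2s u² + 4u⁴. As u² does not tend to
infinity, it is nonincreasing and (u²)'' takes arbitrarily small values at arbitrarily large s. The
monotone function h therefore decreases to 0, and strictly enough to be positive (`piiEnergy_pos`,
`tendsto_piiEnergy`).

For the boundary condition, R = u² / h solves R' = 2(u'/u)R + R², where (u'/u)² = s + u² + 1/R and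
u'/u ≤ 0 for s ≥ 0. Comparing with B = 2√s + k/s through the sign of u²/B - h, which tends to 0 at
+∞, gives R = 2√s + 1/s + o(1/s). The value k = 1 comes from ((B - B'/B)/2)² = s + (k - 1/2)/√s +
..., which has to match s + 1/(2√s). -/

theorem integrableOn_exp_sub_cube (t : ℝ) :
    MeasureTheory.IntegrableOn (fun r : ℝ => Real.exp (t * r - r ^ 3 / 3)) (Set.Ioi 0) := by
  refine integrable_of_isBigO_exp_neg (b := 1) one_pos (by fun_prop) ?_
  refine IsBigO.of_bound 1 ?_
  filter_upwards [eventually_ge_atTop (3 * (|t| + 1)), eventually_ge_atTop 1] with r hr hr1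
  rw [Real.norm_eq_abs, Real.norm_eq_abs, Real.abs_exp, Real.abs_exp, one_mul, Real.exp_le_exp]
  have h1 : (3 * (|t| + 1)) * r ≤ r ^ 3 := by
    have : r * r ≤ r ^ 3 := by nlinarith [mul_nonneg (by positivity : 0 ≤ r * r) (sub_nonneg.2 hr1)]
    nlinarith
  nlinarith [le_abs_self t]

/-- The measure `exp(-r³/3) dr` on the half-line. -/
noncomputable def cubeExpMeasure : MeasureTheory.Measure ℝ :=
  (MeasureTheory.volume.restrict (Set.Ioi (0 : ℝ))).withDensity
    fun r => ENNReal.ofReal (Real.exp (-r ^ 3 / 3))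

theorem integrableExpSet_cubeExpMeasure :
    ProbabilityTheory.integrableExpSet id cubeExpMeasure = Set.univ := by
  refine Set.eq_univ_of_forall fun t => ?_
  change MeasureTheory.Integrable (fun r : ℝ => Real.exp (t * id r)) cubeExpMeasure
  rw [cubeExpMeasure, MeasureTheory.integrable_withDensity_iff_integrable_smul'
    (by fun_prop) (by simp)]
  refine (integrableOn_exp_sub_cube t).congr (Eventually.of_forall fun r => ?_)
  simp only [id, smul_eq_mul]
  rw [ENNReal.toReal_ofReal (Real.exp_pos _).le, ← Real.exp_add]
  ring_nf

theorem analyticAt_complexMGF_cubeExpMeasure (z : ℂ) :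
    AnalyticAt ℂ (ProbabilityTheory.complexMGF id cubeExpMeasure) z :=
  ProbabilityTheory.analyticAt_complexMGF (by simp [integrableExpSet_cubeExpMeasure])

/-- Reading the contour integral as a moment generating function of exp(-r³/3) dr at -x e^{iπ/3}
yields real analyticity of Ai without differentiating under the integral by hand. -/
theorem airyAi_eq_complexMGF (x : ℝ) :
    airyAi x = (1 / Real.pi) * (Complex.exp (Complex.I * Real.pi / 3) *
      ProbabilityTheory.complexMGF id cubeExpMeasure
        (-(x * Complex.exp (Complex.I * Real.pi / 3)))).im := by
  rw [airyAi, ProbabilityTheory.complexMGF, cubeExpMeasure,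
    integral_withDensity_eq_integral_toReal_smul (by fun_prop) (by simp),
    ← MeasureTheory.integral_const_mul]
  congr 2
  refine MeasureTheory.integral_congr_ae (Eventually.of_forall fun r => ?_)
  simp only [id, ENNReal.toReal_ofReal (Real.exp_pos _).le, Complex.real_smul, Complex.ofReal_exp]
  rw [← Complex.exp_add, mul_comm, ← Complex.exp_add, ← Complex.exp_add]
  congr 1
  push_cast
  ring

theorem analyticOnNhd_airyAi : AnalyticOnNhd ℝ airyAi Set.univ := by
  intro x _
  have h : airyAi = fun x : ℝ => (1 / Real.pi) * Complex.imCLM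
      (Complex.exp (Complex.I * Real.pi / 3) * ProbabilityTheory.complexMGF id cubeExpMeasure
        (-(x * Complex.exp (Complex.I * Real.pi / 3)))) :=
    funext airyAi_eq_complexMGF
  rw [h]
  have h1 : AnalyticAt ℝ (fun x : ℝ => -((x : ℂ) * Complex.exp (Complex.I * Real.pi / 3))) x :=
    ((Complex.ofRealCLM.analyticAt x).mul analyticAt_const).neg
  have h2 : AnalyticAt ℝ (fun x : ℝ => ProbabilityTheory.complexMGF id cubeExpMeasure
      (-(x * Complex.exp (Complex.I * Real.pi / 3)))) x :=
    AnalyticAt.fun_comp (analyticAt_complexMGF_cubeExpMeasure _).restrictScalars h1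
  exact analyticAt_const.mul
    (AnalyticAt.fun_comp (Complex.imCLM.analyticAt _) (analyticAt_const.mul h2))

theorem airyAi_exp_re : (Complex.exp (Complex.I * Real.pi / 3)).re = 1 / 2 := by
  rw [show Complex.I * Real.pi / 3 = ((Real.pi / 3 : ℝ) : ℂ) * Complex.I by push_cast; ring,
    Complex.exp_ofReal_mul_I_re, Real.cos_pi_div_three]

theorem airyAi_exp_im : (Complex.exp (Complex.I * Real.pi / 3)).im = √3 / 2 := by
  rw [show Complex.I * Real.pi / 3 = ((Real.pi / 3 : ℝ) : ℂ) * Complex.I by push_cast; ring,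
    Complex.exp_ofReal_mul_I_im, Real.sin_pi_div_three]

theorem airyAi_zero_pos : 0 < airyAi 0 := by
  have hI : (∫ r in Set.Ioi (0 : ℝ),
      Complex.exp (-(r : ℂ) ^ 3 / 3 - (0 : ℝ) * (r * Complex.exp (Complex.I * Real.pi / 3)))
        * Complex.exp (Complex.I * Real.pi / 3))
      = ((∫ r in Set.Ioi (0 : ℝ), Real.exp (-r ^ 3 / 3) : ℝ) : ℂ)
        * Complex.exp (Complex.I * Real.pi / 3) := by
    rw [MeasureTheory.integral_mul_const, ← integral_complex_ofReal]
    congr 2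
    ext r
    push_cast
    congr 1
    ring
  rw [airyAi, hI, Complex.im_ofReal_mul, airyAi_exp_im]
  have hpos : 0 < ∫ r in Set.Ioi (0 : ℝ), Real.exp (-r ^ 3 / 3) := by
    have hi := integrableOn_exp_sub_cube 0
    simp only [zero_mul, zero_sub, ← neg_div] at hi
    have : (0 : ENNReal) < MeasureTheory.volume.restrict (Set.Ioi (0 : ℝ)) Set.univ := by simp
    have : NeZero (MeasureTheory.volume.restrict (Set.Ioi (0 : ℝ))) :=
      ⟨fun h => by simp [h] at this⟩
    exact MeasureTheory.integral_exp_pos hi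
  positivity

theorem airyAi_bounded : ∃ C, ∀ x, 0 ≤ x → |airyAi x| ≤ C := by
  refine ⟨(1 / Real.pi) * ∫ r in Set.Ioi (0 : ℝ), Real.exp (0 * r - r ^ 3 / 3), fun x hx => ?_⟩
  rw [airyAi, abs_mul, abs_of_pos (by positivity : 0 < 1 / Real.pi)]
  refine mul_le_mul_of_nonneg_left ?_ (by positivity)
  refine (Complex.abs_im_le_norm _).trans ?_
  refine MeasureTheory.norm_integral_le_of_norm_le (integrableOn_exp_sub_cube 0) ?_
  filter_upwards [MeasureTheory.ae_restrict_mem measurableSet_Ioi] with r hr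
  rw [← Complex.exp_add, Complex.norm_exp, Real.exp_le_exp]
  -- Since Re e^{iπ/3} = 1/2, the factor containing x has modulus exp(-x r / 2) ≤ 1.
  have h1 : (-(r : ℂ) ^ 3 / 3 - x * (r * Complex.exp (Complex.I * Real.pi / 3)) +
      Complex.I * Real.pi / 3).re = -r ^ 3 / 3 - x * (r * (1 / 2)) := by
    have h2 : (-(r : ℂ) ^ 3 / 3) = ((-r ^ 3 / 3 : ℝ) : ℂ) := by push_cast; ring
    have h3 : (Complex.I * Real.pi / 3) = Complex.I * ((Real.pi / 3 : ℝ) : ℂ) := by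
      push_cast; ring
    rw [Complex.add_re, Complex.sub_re, h2, Complex.ofReal_re, Complex.re_ofReal_mul,
      Complex.re_ofReal_mul, airyAi_exp_re, h3, Complex.I_mul_re, Complex.ofReal_im]
    ring
  rw [h1]
  have : 0 ≤ x * (r * (1 / 2)) := mul_nonneg hx (mul_nonneg (le_of_lt hr) (by norm_num))
  linarith

/-- By the identity theorem, vanishing near +∞ would propagate to the point 0, where Ai(0) > 0. -/
theorem airyAi_frequently_ne_zero : ∃ᶠ x in atTop, airyAi x ≠ 0 := by
  intro h
  obtain ⟨a, ha⟩ := eventually_atTop.1 h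
  have h0 : airyAi =ᶠ[𝓝 (a + 1)] fun _ => 0 := by
    filter_upwards [lt_mem_nhds (lt_add_one a)] with x hx
    exact not_not.1 (ha x hx.le)
  have := analyticOnNhd_airyAi.eqOn_of_preconnected_of_eventuallyEq
    analyticOnNhd_const isPreconnected_univ (Set.mem_univ _) h0 (Set.mem_univ 0)
  exact airyAi_zero_pos.ne' this

/-! ### Real functions on a half-line -/

theorem antitoneOn_Ici_of_hasDerivAt {f f' : ℝ → ℝ} {S : ℝ}
    (hf : ∀ s, S ≤ s → HasDerivAt f (f' s) s) (hf' : ∀ s, S ≤ s → f' s ≤ 0) :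
    AntitoneOn f (Set.Ici S) := by
  refine antitoneOn_of_deriv_nonpos (convex_Ici S)
    (fun s hs => (hf s hs).continuousAt.continuousWithinAt)
    (fun s hs => (hf s (interior_subset hs)).differentiableAt.differentiableWithinAt)
    fun s hs => ?_
  rw [(hf s (interior_subset hs)).deriv]
  exact hf' s (interior_subset hs)

theorem tendsto_atTop_of_le_hasDerivAt {f f' : ℝ → ℝ} {S c : ℝ} (hc : 0 < c)
    (hf : ∀ s, S ≤ s → HasDerivAt f (f' s) s) (hf' : ∀ s, S ≤ s → c ≤ f' s) :
    Tendsto f atTop atTop := by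
  have h := antitoneOn_Ici_of_hasDerivAt (f := fun s => c * s - f s) (f' := fun s => c - f' s)
    (fun s hs => 
      (((hasDerivAt_id s).const_mul c).sub (hf s hs)).congr_deriv (by simp))
    (fun s hs => sub_nonpos.2 (hf' s hs))
  have h1 : Tendsto (fun s => c * s - (c * S - f S)) atTop atTop :=
    tendsto_atTop_add_const_right _ _ (tendsto_id.const_mul_atTop hc)
  refine tendsto_atTop_mono' _ ?_ h1
  filter_upwards [eventually_ge_atTop S] with s hs
  have := h (Set.mem_Ici.2 le_rfl) hs hs
  simp only at this
  linarith

theorem nonneg_of_hasDerivAt_nonpos_of_tendsto_zero {f f' : ℝ → ℝ} {S : ℝ}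
    (hf : ∀ s, S ≤ s → HasDerivAt f (f' s) s) (hf' : ∀ s, S ≤ s → f' s ≤ 0)
    (h0 : Tendsto f atTop (𝓝 0)) {s : ℝ} (hs : S ≤ s) : 0 ≤ f s := by
  refine le_of_tendsto h0 ?_
  filter_upwards [eventually_ge_atTop s] with r hr
  exact antitoneOn_Ici_of_hasDerivAt hf hf' hs (hs.trans hr) hr

/-! ### The Hastings–McLeod solution -/

/-- The Hamiltonian `u'² - s u² - u⁴` of the second Painlevé equation with `α = 0`. -/
noncomputable def piiEnergy (u : ℝ → ℝ) (s : ℝ) : ℝ := deriv u s ^ 2 - s * u s ^ 2 - u s ^ 4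

namespace IsHastingsMcLeod

variable {u : ℝ → ℝ}

theorem hasDerivAt (hu : IsHastingsMcLeod u) (s : ℝ) : HasDerivAt u (deriv u s) s :=
  (hu.contDiff.differentiable (by norm_num) s).hasDerivAt

theorem hasDerivAt_deriv (hu : IsHastingsMcLeod u) (s : ℝ) :
    HasDerivAt (deriv u) (2 * u s ^ 3 + s * u s) s := by
  rw [← hu.ode s]
  exact ((hu.contDiff.differentiable_deriv_two) s).hasDerivAt

theorem hasDerivAt_sq (hu : IsHastingsMcLeod u) (s : ℝ) :
    HasDerivAt (fun s => u s ^ 2) (2 * u s * deriv u s) s :=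
  ((hu.hasDerivAt s).pow 2).congr_deriv (by simp)

theorem hasDerivAt_deriv_sq (hu : IsHastingsMcLeod u) (s : ℝ) :
    HasDerivAt (fun s => 2 * u s * deriv u s)
      (2 * deriv u s ^ 2 + 2 * s * u s ^ 2 + 4 * u s ^ 4) s := by
  refine (((hu.hasDerivAt s).const_mul 2).mul (hu.hasDerivAt_deriv s)).congr_deriv ?_
  ring

theorem hasDerivAt_piiEnergy (hu : IsHastingsMcLeod u) (s : ℝ) :
    HasDerivAt (piiEnergy u) (-u s ^ 2) s := by
  refine ((((hu.hasDerivAt_deriv s).pow 2).sub ((hasDerivAt_id s).mul (hu.hasDerivAt_sq s))).sub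
    ((hu.hasDerivAt s).pow 4)).congr_deriv ?_
  simp only [id]
  push_cast
  ring

theorem piiEnergy_antitone (hu : IsHastingsMcLeod u) : Antitone (piiEnergy u) :=
  antitone_of_deriv_nonpos (fun s => (hu.hasDerivAt_piiEnergy s).differentiableAt) fun s => by
    rw [(hu.hasDerivAt_piiEnergy s).deriv]
    nlinarith [sq_nonneg (u s)]

theorem not_tendsto_sq (hu : IsHastingsMcLeod u) : ¬ Tendsto (fun s => u s ^ 2) atTop atTop := by
  intro h
  obtain ⟨C, hC⟩ := airyAi_bounded
  obtain ⟨K, hK, hb⟩ := hu.asymp.isBigO.exists_pos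
  obtain ⟨s, h1, h2, h3⟩ := ((h.eventually_gt_atTop ((K * C) ^ 2)).and
    (hb.bound.and (eventually_ge_atTop 0))).exists
  rw [Real.norm_eq_abs, Real.norm_eq_abs] at h2
  have h4 : |u s| ≤ K * C := h2.trans (mul_le_mul_of_nonneg_left (hC s h3) hK.le)
  have h5 := pow_le_pow_left₀ (abs_nonneg _) h4 2
  rw [sq_abs] at h5
  linarith

theorem frequently_ne_zero (hu : IsHastingsMcLeod u) : ∃ᶠ s in atTop, u s ≠ 0 := by
  intro h
  have h1 : u =ᶠ[atTop] 0 := h.mono fun s hs => not_not.1 hs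
  have h2 : airyAi =ᶠ[atTop] 0 :=
    isEquivalent_zero_iff_eventually_zero.1 (hu.asymp.symm.congr_right h1)
  exact airyAi_frequently_ne_zero (h2.mono fun s hs => not_not.2 hs)

/-- The expression is (u²)''. A positive lower bound for it would drive (u²)', and then u², to
infinity. -/
theorem exists_second_deriv_sq_lt (hu : IsHastingsMcLeod u) (S : ℝ) {c : ℝ} (hc : 0 < c) :
    ∃ s, S ≤ s ∧ 2 * deriv u s ^ 2 + 2 * s * u s ^ 2 + 4 * u s ^ 4 < c := by
  by_contra! h
  have h1 := tendsto_atTop_of_le_hasDerivAt hc (fun s _ => hu.hasDerivAt_deriv_sq s) h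
  obtain ⟨T, hT⟩ := eventually_atTop.1 (h1.eventually_ge_atTop 1)
  exact hu.not_tendsto_sq
    (tendsto_atTop_of_le_hasDerivAt one_pos (fun s _ => hu.hasDerivAt_sq s) hT)

theorem piiEnergy_nonneg (hu : IsHastingsMcLeod u) (s : ℝ) : 0 ≤ piiEnergy u s := by
  by_contra! h
  -- For r ≥ 0 one has -h(r) ≤ r u² + u⁴ ≤ (u²)''(r) / 2, so a small (u²)'' contradicts h(r) ≤ h(s)
  -- < 0.
  obtain ⟨r, hr, h1⟩ := hu.exists_second_deriv_sq_lt (max s 0) (neg_pos.2 h)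
  have h2 := hu.piiEnergy_antitone (le_of_max_le_left hr)
  have h3 : 0 ≤ r * u r ^ 2 := mul_nonneg (le_of_max_le_right hr) (sq_nonneg _)
  rw [piiEnergy] at h2
  nlinarith [sq_nonneg (deriv u r), sq_nonneg (u r ^ 2)]

/-- A zero of h would make h vanish from there on, being antitone and nonnegative; then h' = -u²
forces u = 0 near +∞. -/
theorem piiEnergy_pos (hu : IsHastingsMcLeod u) (s : ℝ) : 0 < piiEnergy u s := by
  refine (hu.piiEnergy_nonneg s).lt_of_ne fun h => ?_
  have h1 : ∀ r, s ≤ r → piiEnergy u r = 0 := fun r hr =>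
    le_antisymm (h ▸ hu.piiEnergy_antitone hr) (hu.piiEnergy_nonneg r)
  obtain ⟨r, h2, h3⟩ := (hu.frequently_ne_zero.and_eventually (eventually_gt_atTop s)).exists
  have h4 : piiEnergy u =ᶠ[𝓝 r] fun _ => 0 := by
    filter_upwards [lt_mem_nhds h3] with x hx using h1 x hx.le
  have h5 := (hu.hasDerivAt_piiEnergy r).unique ((hasDerivAt_const r (0 : ℝ)).congr_of_eventuallyEq h4)
  simp [h2] at h5

theorem tendsto_piiEnergy (hu : IsHastingsMcLeod u) : Tendsto (piiEnergy u) atTop (𝓝 0) := by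
  refine tendsto_order.2 ⟨fun a ha => Eventually.of_forall fun s => ha.trans (hu.piiEnergy_pos s),
    fun c hc => ?_⟩
  obtain ⟨s, hs, h1⟩ := hu.exists_second_deriv_sq_lt 0 hc
  filter_upwards [eventually_ge_atTop s] with r hr
  refine (hu.piiEnergy_antitone hr).trans_lt ?_
  rw [piiEnergy]
  have h3 : 0 ≤ s * u s ^ 2 := mul_nonneg hs (sq_nonneg _)
  nlinarith [sq_nonneg (deriv u s), sq_nonneg (u s ^ 2)]

/-- By convexity of u² on [0, ∞), a positive slope would persist and make u² unbounded. -/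
theorem mul_deriv_nonpos (hu : IsHastingsMcLeod u) {s : ℝ} (hs : 0 ≤ s) :
    2 * u s * deriv u s ≤ 0 := by
  by_contra! h
  refine hu.not_tendsto_sq (tendsto_atTop_of_le_hasDerivAt (S := s) h (fun s _ => hu.hasDerivAt_sq s)
    fun r hr => ?_)
  have h1 := antitoneOn_Ici_of_hasDerivAt (S := s) (fun s _ => (hu.hasDerivAt_deriv_sq s).neg)
    (fun x hx => ?_) (Set.mem_Ici.2 le_rfl) hr hr
  · simpa using h1
  · have h3 : 0 ≤ x * u x ^ 2 := mul_nonneg (hs.trans hx) (sq_nonneg _)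
    nlinarith [sq_nonneg (deriv u x), sq_nonneg (u x ^ 2)]

theorem ne_zero (hu : IsHastingsMcLeod u) {s : ℝ} (hs : 0 ≤ s) : u s ≠ 0 := by
  intro h
  obtain ⟨r, h2, h3⟩ := (hu.frequently_ne_zero.and_eventually (eventually_ge_atTop s)).exists
  have h1 := antitoneOn_Ici_of_hasDerivAt (S := s) (fun s _ => hu.hasDerivAt_sq s)
    (fun x hx => hu.mul_deriv_nonpos (hs.trans hx)) (Set.mem_Ici.2 le_rfl) h3 h3
  simp only [h] at h1
  exact h2 (pow_eq_zero_iff two_ne_zero |>.1 (le_antisymm (by simpa using h1) (sq_nonneg _)))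

theorem deriv_ne_zero_of_eq_zero (hu : IsHastingsMcLeod u) {s : ℝ} (hs : u s = 0) :
    deriv u s ≠ 0 := by
  intro h
  have := hu.piiEnergy_pos s
  simp [piiEnergy, hs, h] at this

/-- The zeros in [a, ∞) lie in the compact [a, 0], and each is isolated because h = u'² > 0 there.
-/
theorem finite_zeros (hu : IsHastingsMcLeod u) (a : ℝ) : {s : ℝ | a ≤ s ∧ u s = 0}.Finite := by
  have hsub : {s : ℝ | a ≤ s ∧ u s = 0} ⊆ Set.Icc a 0 := fun s hs =>
    ⟨hs.1, not_lt.1 fun h => hu.ne_zero h.le hs.2⟩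
  by_contra hinf
  obtain ⟨x, -, hx⟩ := Set.Infinite.exists_accPt_of_subset_isCompact hinf isCompact_Icc hsub
  have hx1 : ∃ᶠ y in 𝓝[≠] x, u y = 0 :=
    (accPt_iff_frequently_nhdsNE.1 hx).mono fun y hy => hy.2
  have hx0 : u x = 0 := by
    by_contra h
    exact hx1 ((hu.contDiff.continuous.continuousAt.eventually_ne h).filter_mono
      nhdsWithin_le_nhds)
  exact hx1 ((hu.hasDerivAt x).eventually_ne (c := 0) (hu.deriv_ne_zero_of_eq_zero hx0))

/-! ### Asymptotics of `u² / (u'² - s u² - u⁴)` -/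

theorem logDeriv_nonpos (hu : IsHastingsMcLeod u) {s : ℝ} (hs : 0 ≤ s) : deriv u s / u s ≤ 0 := by
  have h := hu.mul_deriv_nonpos hs
  rw [div_eq_mul_inv, ← mul_inv_cancel_right₀ (hu.ne_zero hs) (deriv u s)]
  have h1 : deriv u s * u s * (u s)⁻¹ * (u s)⁻¹ = (2 * u s * deriv u s) * ((u s)⁻¹ ^ 2 / 2) := by
    ring
  rw [h1]
  exact mul_nonpos_of_nonpos_of_nonneg h (by positivity)

theorem logDeriv_sq (hu : IsHastingsMcLeod u) {s : ℝ} (hs : 0 ≤ s) :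
    (deriv u s / u s) ^ 2 = s + u s ^ 2 + piiEnergy u s / u s ^ 2 := by
  have := hu.ne_zero hs
  rw [piiEnergy]
  field_simp
  ring

theorem deriv_eq_logDeriv_mul (hu : IsHastingsMcLeod u) {s : ℝ} (hs : 0 ≤ s) :
    2 * u s * deriv u s = 2 * (deriv u s / u s) * u s ^ 2 := by
  have := hu.ne_zero hs
  field_simp

theorem logDeriv_le_neg (hu : IsHastingsMcLeod u) {s w : ℝ} (hs : 0 ≤ s)
    (h : w ^ 2 ≤ s + u s ^ 2 + piiEnergy u s / u s ^ 2) : deriv u s / u s ≤ -w := by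
  rw [← hu.logDeriv_sq hs] at h
  have h1 := (le_abs_self w).trans (sq_le_sq.1 h)
  rw [abs_of_nonpos (hu.logDeriv_nonpos hs)] at h1
  linarith

theorem neg_le_logDeriv (hu : IsHastingsMcLeod u) {s w : ℝ} (hs : 0 ≤ s) (hw : 0 ≤ w)
    (h : s + u s ^ 2 + piiEnergy u s / u s ^ 2 ≤ w ^ 2) : -w ≤ deriv u s / u s := by
  rw [← hu.logDeriv_sq hs] at h
  exact (abs_le.1 (abs_le_of_sq_le_sq h hw)).1

/-- For s ≥ 2, (u'/u)² ≥ s ≥ 1 and u'/u ≤ 0 give s³u² the logarithmic derivative 3/s + 2u'/u ≤ 3/s -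
2 < 0. This crude decay replaces the exponential decay of Ai in all later estimates. -/
theorem eventually_sq_le (hu : IsHastingsMcLeod u) {ε : ℝ} (hε : 0 < ε) :
    ∀ᶠ s in atTop, u s ^ 2 ≤ ε / s := by
  have h := antitoneOn_Ici_of_hasDerivAt (S := 2) (f := fun s => s ^ 3 * u s ^ 2)
    (fun s _ => (hasDerivAt_pow 3 s).mul (hu.hasDerivAt_sq s)) fun s hs => by
      have hs : (2 : ℝ) ≤ s := hs
      rw [hu.deriv_eq_logDeriv_mul (by linarith)]
      have h1 : deriv u s / u s ≤ -1 := hu.logDeriv_le_neg (by linarith) (by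
        have := hu.piiEnergy_pos s
        have : 0 ≤ piiEnergy u s / u s ^ 2 := by positivity
        nlinarith [sq_nonneg (u s)])
      have h2 : ((3 : ℕ) : ℝ) * s ^ (3 - 1) * u s ^ 2 + s ^ 3 * (2 * (deriv u s / u s) * u s ^ 2)
        = s ^ 2 * u s ^ 2 * (3 + 2 * (s * (deriv u s / u s))) := by
        norm_num; ring
      rw [h2]
      refine mul_nonpos_of_nonneg_of_nonpos (by positivity) ?_
      nlinarith
  filter_upwards [eventually_ge_atTop 2, eventually_ge_atTop (8 * u 2 ^ 2 / ε)] with s hs h1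
  have h2 := h (Set.mem_Ici.2 le_rfl) hs hs
  norm_num at h2
  rw [div_le_iff₀ hε] at h1
  rw [le_div_iff₀ (by linarith)]
  have h3 : s * (s * (u s ^ 2 * s)) ≤ s * ε := by
    calc _ = s ^ 3 * u s ^ 2 := by ring
      _ ≤ _ := h2.trans h1
  have h4 := le_of_mul_le_mul_left h3 (by linarith)
  nlinarith [mul_nonneg (sq_nonneg (u s)) (by linarith : 0 ≤ s)]

theorem tendsto_sq (hu : IsHastingsMcLeod u) : Tendsto (fun s => u s ^ 2) atTop (𝓝 0) :=
  tendsto_of_tendsto_of_tendsto_of_le_of_le' tendsto_const_nhds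
    (tendsto_inv_atTop_zero (𝕜 := ℝ)) (Eventually.of_forall fun s => sq_nonneg _)
    ((hu.eventually_sq_le one_pos).mono fun s hs => by simpa using hs)

theorem tendsto_sq_div_sub (hu : IsHastingsMcLeod u) {B : ℝ → ℝ}
    (hB : ∀ᶠ s in atTop, 1 ≤ B s) :
    Tendsto (fun s => u s ^ 2 / B s - piiEnergy u s) atTop (𝓝 0) := by
  have h : Tendsto (fun s => u s ^ 2 / B s) atTop (𝓝 0) :=
    tendsto_of_tendsto_of_tendsto_of_le_of_le' tendsto_const_nhds hu.tendsto_sq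
      (hB.mono fun s hs => div_nonneg (sq_nonneg _) (by linarith))
      (hB.mono fun s hs => div_le_self (sq_nonneg _) hs)
  simpa using h.sub hu.tendsto_piiEnergy

/-- The bracket vanishes exactly when B satisfies the Riccati equation B' = 2(u'/u)B + B² of u²/h.
Comparing u'/u with -(B - B'/B)/2 thus gives monotonicity, and the zero limit at +∞ then fixes the
sign. -/
theorem hasDerivAt_sq_div_sub (hu : IsHastingsMcLeod u) {B : ℝ → ℝ} {B' s : ℝ} (hs : 0 ≤ s)
    (hB : HasDerivAt B B' s) (hB1 : 1 ≤ B s) :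
    HasDerivAt (fun s => u s ^ 2 / B s - piiEnergy u s)
      (2 * u s ^ 2 / B s * (deriv u s / u s - -((B s - B' / B s) / 2))) s := by
  have hB0 : B s ≠ 0 := by linarith
  refine (((hu.hasDerivAt_sq s).div hB hB0).sub (hu.hasDerivAt_piiEnergy s)).congr_deriv ?_
  have := hu.ne_zero hs
  field_simp
  ring

/-- A lower barrier for `u² / (u'² - s u² - u⁴)`. -/
theorem eventually_barrier_le (hu : IsHastingsMcLeod u) {B B' : ℝ → ℝ}
    (hB : ∀ᶠ s in atTop, HasDerivAt B (B' s) s) (hB1 : ∀ᶠ s in atTop, 1 ≤ B s)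
    (h : ∀ᶠ s in atTop,
      ((B s - B' s / B s) / 2) ^ 2 ≤ s + u s ^ 2 + piiEnergy u s / u s ^ 2) :
    ∀ᶠ s in atTop, B s ≤ u s ^ 2 / piiEnergy u s := by
  obtain ⟨S, hS⟩ := eventually_atTop.1 (hB.and (hB1.and (h.and (eventually_ge_atTop 0))))
  filter_upwards [eventually_ge_atTop S] with s hs
  have := nonneg_of_hasDerivAt_nonpos_of_tendsto_zero
    (fun s hs => hu.hasDerivAt_sq_div_sub (hS s hs).2.2.2 (hS s hs).1 (hS s hs).2.1)
    (fun s hs => mul_nonpos_of_nonneg_of_nonpos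
      (div_nonneg (by positivity) (zero_le_one.trans (hS s hs).2.1))
      (sub_nonpos.2 (hu.logDeriv_le_neg (hS s hs).2.2.2 (hS s hs).2.2.1)))
    (hu.tendsto_sq_div_sub hB1) hs
  have hB0 : 0 < B s := by linarith [(hS s hs).2.1]
  rw [le_div_iff₀ (hu.piiEnergy_pos s), mul_comm, ← le_div_iff₀ hB0]
  linarith

/-- An upper barrier for `u² / (u'² - s u² - u⁴)`. -/
theorem eventually_le_barrier (hu : IsHastingsMcLeod u) {B B' : ℝ → ℝ}
    (hB : ∀ᶠ s in atTop, HasDerivAt B (B' s) s) (hB1 : ∀ᶠ s in atTop, 1 ≤ B s)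
    (hw : ∀ᶠ s in atTop, 0 ≤ (B s - B' s / B s) / 2)
    (h : ∀ᶠ s in atTop,
      s + u s ^ 2 + piiEnergy u s / u s ^ 2 ≤ ((B s - B' s / B s) / 2) ^ 2) :
    ∀ᶠ s in atTop, u s ^ 2 / piiEnergy u s ≤ B s := by
  obtain ⟨S, hS⟩ := eventually_atTop.1
    (hB.and (hB1.and (h.and ((eventually_ge_atTop 0).and hw))))
  filter_upwards [eventually_ge_atTop S] with s hs
  have := nonneg_of_hasDerivAt_nonpos_of_tendsto_zero
    (fun s hs => (hu.hasDerivAt_sq_div_sub (hS s hs).2.2.2.1 (hS s hs).1 (hS s hs).2.1).neg)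
    (fun s hs => neg_nonpos.2 (mul_nonneg
      (div_nonneg (by positivity) (zero_le_one.trans (hS s hs).2.1))
      (sub_nonneg.2 (hu.neg_le_logDeriv (hS s hs).2.2.2.1 (hS s hs).2.2.2.2 (hS s hs).2.2.1))))
    (neg_zero (G := ℝ) ▸ (hu.tendsto_sq_div_sub hB1).neg) hs
  have hB0 : 0 < B s := by linarith [(hS s hs).2.1]
  rw [div_le_iff₀ (hu.piiEnergy_pos s), mul_comm, ← div_le_iff₀ hB0]
  simpa using this

end IsHastingsMcLeod

/-! ### Barriers 2√s + k/s and the two-term expansion of u²/h. -/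

namespace IsHastingsMcLeod

variable {u : ℝ → ℝ}

/-- The comparison function `2√s + k/s`. -/
theorem hasDerivAt_two_sqrt_add_div {s : ℝ} (k : ℝ) (hs : 0 < s) :
    HasDerivAt (fun s => 2 * √s + k / s) (1 / √s - k / s ^ 2) s := by
  refine (((Real.hasDerivAt_sqrt hs.ne').const_mul 2).add
    ((hasDerivAt_inv hs.ne').const_mul k)).congr_deriv ?_
  have := Real.sqrt_ne_zero'.2 hs
  field_simp
  ring

/-- Start of a bootstrap: this bound needs only u² ≥ 0 and h/u² ≥ 0. It bounds h/u² above, which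
yields the upper barrier; that in turn bounds h/u² below, which yields the sharp lower barrier. -/
theorem eventually_lower (hu : IsHastingsMcLeod u) :
    ∀ᶠ s in atTop, 2 * √s ≤ u s ^ 2 / piiEnergy u s := by
  have hs1 : ∀ᶠ s : ℝ in atTop, 1 ≤ s := eventually_ge_atTop 1
  refine hu.eventually_barrier_le (B' := fun s => 2 * (1 / (2 * √s)))
    (hs1.mono fun s hs => (Real.hasDerivAt_sqrt (by linarith)).const_mul 2)
    (hs1.mono fun s hs => by linarith [Real.one_le_sqrt.2 hs]) (hs1.mono fun s hs => ?_)
  have hx := Real.one_le_sqrt.2 hs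
  have hs2 : s = √s ^ 2 := (Real.sq_sqrt (by linarith)).symm
  have h1 : 0 ≤ piiEnergy u s / u s ^ 2 := div_nonneg (hu.piiEnergy_pos s).le (sq_nonneg _)
  have h2 : 2 * (1 / (2 * √s)) / (2 * √s) = 1 / (2 * s) := by
    rw [hs2]; simp only [Real.sqrt_sq (zero_le_one.trans hx)]; field_simp
  have h3 : 0 ≤ 1 / (2 * s) := by positivity
  have h4 : 1 / (2 * s) ≤ 1 := by rw [div_le_one (by linarith)]; linarith
  rw [h2]
  calc ((2 * √s - 1 / (2 * s)) / 2) ^ 2 ≤ √s ^ 2 :=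
        pow_le_pow_left₀ (by linarith) (by linarith) 2
    _ = s := hs2.symm
    _ ≤ _ := by nlinarith [sq_nonneg (u s)]

theorem eventually_upper (hu : IsHastingsMcLeod u) {ε : ℝ} (hε : 0 < ε) :
    ∀ᶠ s in atTop, u s ^ 2 / piiEnergy u s ≤ 2 * √s + (1 + ε) / s := by
  have hs1 : ∀ᶠ s : ℝ in atTop, 1 ≤ s := eventually_ge_atTop 1
  -- The constant is k/2 - 1/4 with k = 1 + ε, where 1/4 is half of s · B'/B to leading order. Its
  -- square leaves a surplus ε/√s over s + 1/(2√s), which absorbs u².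
  have key : ∀ᶠ s : ℝ in atTop,
      √s + (1 / 4 + ε / 2) / s ≤ ((2 * √s + (1 + ε) / s) -
        (1 / √s - (1 + ε) / s ^ 2) / (2 * √s + (1 + ε) / s)) / 2 := hs1.mono fun s hs => by
    have hx := Real.one_le_sqrt.2 hs
    have hs2 : s = √s ^ 2 := (Real.sq_sqrt (by linarith)).symm
    have h1 : (1 / √s - (1 + ε) / s ^ 2) / (2 * √s + (1 + ε) / s) ≤ (1 / √s) / (2 * √s) :=
      div_le_div₀ (by positivity) (sub_le_self _ (by positivity)) (by positivity)
        (le_add_of_nonneg_right (by positivity))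
    have h2 : 1 / √s / (2 * √s) = (1 / 2) / s := by
      rw [hs2]; simp only [Real.sqrt_sq (zero_le_one.trans hx)]; field_simp
    have h3 : (1 / 4 + ε / 2) / s = ((1 + ε) / s - (1 / 2) / s) / 2 := by ring
    rw [h2] at h1
    linarith
  refine hu.eventually_le_barrier
    (hs1.mono fun s hs => hasDerivAt_two_sqrt_add_div _ (by linarith))
    (hs1.mono fun s hs => ?_) ((hs1.and key).mono fun s ⟨hs, h⟩ => le_trans (by positivity) h) ?_
  · have : 0 ≤ (1 + ε) / s := by positivity
    linarith [Real.one_le_sqrt.2 hs]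
  filter_upwards [hs1, key, hu.eventually_lower, hu.eventually_sq_le hε] with s hs hk hl hg
  refine le_trans ?_ (pow_le_pow_left₀ (by positivity) hk 2)
  have hx := Real.one_le_sqrt.2 hs
  have hs2 : s = √s ^ 2 := (Real.sq_sqrt (by linarith)).symm
  have h1 : piiEnergy u s / u s ^ 2 ≤ 1 / (2 * √s) := by
    rw [← one_div_div (u s ^ 2)]
    exact one_div_le_one_div_of_le (by positivity) hl
  have h2 : ε / s ≤ ε / √s := by
    refine div_le_div_of_nonneg_left hε.le (by positivity) ?_
    nlinarith
  have h3 : (√s + (1 / 4 + ε / 2) / s) ^ 2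
      = s + 1 / (2 * √s) + ε / √s + ((1 / 4 + ε / 2) / s) ^ 2 := by
    generalize √s = x at *
    subst hs2
    field_simp
    ring
  rw [h3]
  nlinarith [sq_nonneg ((1 / 4 + ε / 2) / s)]

theorem eventually_lower_sharp (hu : IsHastingsMcLeod u) {ε : ℝ} (hε : 0 < ε) (hε1 : ε < 1) :
    ∀ᶠ s in atTop, 2 * √s + (1 - ε) / s ≤ u s ^ 2 / piiEnergy u s := by
  have hs1 : ∀ᶠ s : ℝ in atTop, 1 ≤ s := eventually_ge_atTop 1
  refine hu.eventually_barrier_le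
    (hs1.mono fun s hs => hasDerivAt_two_sqrt_add_div _ (by linarith))
    (hs1.mono fun s hs => ?_) ?_
  · have : 0 ≤ (1 - ε) / s := div_nonneg (by linarith) (by linarith)
    linarith [Real.one_le_sqrt.2 hs]
  filter_upwards [hs1, hu.eventually_upper one_pos, eventually_ge_atTop (2 / ε)] with s hs hl hb
  have hx := Real.one_le_sqrt.2 hs
  have hs2 : s = √s ^ 2 := (Real.sq_sqrt (by linarith)).symm
  have h1 : 1 / (2 * √s + (1 + 1) / s) ≤ piiEnergy u s / u s ^ 2 := by
    rw [← one_div_div (u s ^ 2)]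
    refine one_div_le_one_div_of_le (div_pos ?_ (hu.piiEnergy_pos s)) hl
    have := hu.ne_zero (zero_le_one.trans hs)
    positivity
  refine le_trans ?_ (add_le_add (le_add_of_nonneg_right (sq_nonneg (u s))) h1)
  rw [div_le_iff₀ hε] at hb
  generalize √s = x at *
  subst hs2
  have hx0 : 0 < x := by linarith
  -- The expansion parameter is δ = s^{-3/2}: after a factor x² is removed, the inequality involves
  -- only δ and ε. The threshold s ≥ 2/ε gives 2δ ≤ ε, so that the first-order gain in εδ dominates
  -- all terms in δ².
  have hy : ∃ δ, δ = 1 / x ^ 3 ∧ 0 < δ ∧ δ ≤ 1 ∧ 2 * δ ≤ ε := by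
    refine ⟨1 / x ^ 3, rfl, by positivity, ?_, ?_⟩
    · rw [div_le_one (by positivity)]
      exact one_le_pow₀ hx
    · rw [mul_one_div, div_le_iff₀ (by positivity)]
      nlinarith [mul_le_mul_of_nonneg_left hx (by positivity : 0 ≤ ε * x ^ 2)]
  obtain ⟨δ, hδ, hδ0, hδ1, hδε⟩ := hy
  have e1 : 1 / (2 * x + (1 + 1) / x ^ 2) = x ^ 2 * (δ / (2 * (1 + δ))) := by
    rw [hδ]; field_simp; ring
  have e2 : 2 * x + (1 - ε) / x ^ 2 = x * (2 + (1 - ε) * δ) := by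
    rw [hδ]; field_simp
  have e3 : 1 / x - (1 - ε) / (x ^ 2) ^ 2 = x ^ 2 * (δ * (1 - (1 - ε) * δ)) := by
    rw [hδ]; field_simp
  have hk : 0 < 2 + (1 - ε) * δ := by nlinarith
  have e4 : (x * (2 + (1 - ε) * δ) - x ^ 2 * (δ * (1 - (1 - ε) * δ)) / (x * (2 + (1 - ε) * δ))) / 2
      = x * ((2 + (1 - ε) * δ - δ * (1 - (1 - ε) * δ) / (2 + (1 - ε) * δ)) / 2) := by
    field_simp
  rw [e1, e2, e3, e4, mul_pow, ← mul_one_add]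
  refine mul_le_mul_of_nonneg_left ?_ (sq_nonneg x)
  have f1 : δ * (1 - (1 - ε) * δ) / (2 + (1 - ε) * δ) ≤ 1 := by
    rw [div_le_one hk]
    nlinarith [mul_pos hδ0 hδ0]
  have f2 : δ / 2 * (1 - 2 * δ) ≤ δ * (1 - (1 - ε) * δ) / (2 + (1 - ε) * δ) := by
    rw [le_div_iff₀ hk]
    have : 0 ≤ δ * (δ * (4 - 3 * (1 - ε) + 2 * ((1 - ε) * δ))) := by
      have : 0 ≤ (1 - ε) * δ := mul_nonneg (by linarith) hδ0.le
      exact mul_nonneg hδ0.le (mul_nonneg hδ0.le (by linarith))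
    nlinarith
  have f3 : δ / 2 * (1 - δ) ≤ δ / (2 * (1 + δ)) := by
    rw [le_div_iff₀ (by positivity)]
    nlinarith [pow_pos hδ0 3]
  have f4 : (2 + (1 - ε) * δ - δ * (1 - (1 - ε) * δ) / (2 + (1 - ε) * δ)) / 2
      ≤ 1 + δ * (1 / 4 - ε / 4) := by nlinarith
  have f5 : 0 ≤ (1 - ε) * δ := mul_nonneg (by linarith) hδ0.le
  refine (pow_le_pow_left₀ (by linarith) f4 2).trans ((?_ : _ ≤ 1 + δ / 2 * (1 - δ)).trans
    (by linarith))
  have f6 : (1 / 4 - ε / 4) ^ 2 ≤ (1 / 4) ^ 2 := pow_le_pow_left₀ (by linarith) (by linarith) 2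
  nlinarith [mul_le_mul_of_nonneg_left f6 (sq_nonneg δ), mul_le_mul_of_nonneg_left hδε hδ0.le]

theorem eventually_abs_sub_le (hu : IsHastingsMcLeod u) {ε : ℝ} (hε : 0 < ε) :
    ∀ᶠ s in atTop,
      |u s ^ 2 / piiEnergy u s - piiEnergy u s - (2 * √s + 1 / s)| ≤ ε / s := by
  obtain ⟨δ, hδ, hδε, hδ1⟩ : ∃ δ : ℝ, 0 < δ ∧ δ ≤ ε / 2 ∧ δ < 1 :=
    ⟨min (ε / 2) (1 / 2), by positivity, min_le_left _ _,
      (min_le_right _ _).trans_lt (by norm_num)⟩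
  filter_upwards [eventually_ge_atTop 1, hu.eventually_lower, hu.eventually_upper hδ,
    hu.eventually_lower_sharp hδ hδ1, hu.eventually_sq_le hδ] with s hs h0 h1 h2 h3
  have hx := Real.one_le_sqrt.2 hs
  have hh := hu.piiEnergy_pos s
  -- The subtracted energy does not affect the expansion: h ≤ u²/(2√s) is itself o(1/s).
  have h4 : piiEnergy u s ≤ δ / s := by
    rw [le_div_iff₀ hh] at h0
    nlinarith
  have h5 : δ / s ≤ (ε / 2) / s := div_le_div_of_nonneg_right hδε (by linarith)
  have h6 : (1 + δ) / s = 1 / s + δ / s := add_div _ _ _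
  have h7 : (1 - δ) / s = 1 / s - δ / s := sub_div _ _ _
  have h8 : (ε / 2) / s = ε / s / 2 := by ring
  rw [abs_le]
  constructor <;> linarith

end IsHastingsMcLeod

/-! ### The shift `T₂` on Hamilton's equations and on the Hamiltonian. -/

namespace PIIState

theorem SolvesOn.T₂ {x : PIIState} {D : Set ℝ} (h : x.SolvesOn D) (hp : ∀ t ∈ D, x.p t ≠ 0) :
    x.T₂.SolvesOn D := by
  have hq : ∀ t ∈ D, HasDerivAt x.T₂.q (x.T₂.p t - x.T₂.q t ^ 2 - t / 2) t := fun t ht => by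
    have h0 := hp t ht
    refine ((h t ht).1.neg.sub ((hasDerivAt_const t x.α₁).div (h t ht).2 h0)).congr_deriv ?_
    simp only [PIIState.T₂]
    field_simp
    ring
  refine fun t ht => ⟨hq t ht, ?_⟩
  have h0 := hp t ht
  -- In terms of the new q, the new p is t - p + 2q², so its derivative follows from the equation
  -- for the new q just proved.
  have hp' : x.T₂.p = fun t => t - x.p t + 2 * x.T₂.q t ^ 2 := by
    ext t
    simp only [PIIState.T₂]
    ring
  have h1 := (((hasDerivAt_id t).sub (h t ht).2).add (((hq t ht).pow 2).const_mul 2))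
  rw [hp']
  refine h1.congr_deriv ?_
  simp only [PIIState.T₂, Nat.cast_ofNat, Nat.add_one_sub_one, pow_one]
  field_simp
  ring

theorem H_T₂ (x : PIIState) {t : ℝ} (hp : x.p t ≠ 0) : x.T₂.H t = x.H t - x.T₂.q t := by
  simp only [H, T₂]
  field_simp
  ring

theorem SolvesOn.hasDerivAt_deriv_q {x : PIIState} {D : Set ℝ} (h : x.SolvesOn D)
    (hD : IsOpen D) {t : ℝ} (ht : t ∈ D) :
    HasDerivAt (deriv x.q) (2 * x.q t ^ 3 + t * x.q t + (x.α₁ - 1 / 2)) t := by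
  have h1 : deriv x.q =ᶠ[𝓝 t] fun t => x.p t - x.q t ^ 2 - t / 2 := by
    filter_upwards [hD.mem_nhds ht] with s hs using (h s hs).1.deriv
  refine HasDerivAt.congr_of_eventuallyEq ?_ h1
  refine (((h t ht).2.sub ((h t ht).1.pow 2)).sub ((hasDerivAt_id t).div_const 2)).congr_deriv ?_
  push_cast
  ring

end PIIState

/-! ### The Gambier transform and its two shifts in terms of u and h. -/

theorem two_rpow_neg_third_pow : ((2 : ℝ) ^ (-(1 / 3) : ℝ)) ^ 3 = 1 / 2 := by
  rw [← Real.rpow_natCast, ← Real.rpow_mul (by norm_num)]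
  norm_num

/-- This makes every constant a polynomial in c = 2^{-1/3}, with c³ = 1/2 as the only relation
needed in the algebra below. -/
theorem two_rpow_third_eq : (2 : ℝ) ^ (1 / 3 : ℝ) = 2 * ((2 : ℝ) ^ (-(1 / 3) : ℝ)) ^ 2 := by
  rw [← Real.rpow_natCast, ← Real.rpow_mul (by norm_num)]
  conv_rhs => rw [← Real.rpow_one_add' (by norm_num) (by norm_num)]
  norm_num

theorem hasDerivAt_gambierArg (t : ℝ) :
    HasDerivAt gambierArg (-(2 : ℝ) ^ (-(1 / 3) : ℝ)) t :=
  ((hasDerivAt_id t).const_mul _).congr_deriv (mul_one _)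

theorem contDiff_gambierArg {n : WithTop ℕ∞} : ContDiff ℝ n gambierArg :=
  contDiff_const.mul contDiff_id

/-- The function `2^{-1/3} (u² / h - h)` with `h = u'² - s u² - u⁴`, as a function of `t`. -/
noncomputable def gambierSigma (u : ℝ → ℝ) (t : ℝ) : ℝ :=
  (2 : ℝ) ^ (-(1 / 3) : ℝ) * (u (gambierArg t) ^ 2 / piiEnergy u (gambierArg t)
    - piiEnergy u (gambierArg t))

namespace IsHastingsMcLeod

variable {u : ℝ → ℝ}

theorem isOpen_ne_zero (hu : IsHastingsMcLeod u) : IsOpen {t : ℝ | u (gambierArg t) ≠ 0} :=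
  isOpen_ne.preimage (hu.contDiff.continuous.comp (contDiff_gambierArg (n := 0)).continuous)

theorem hasDerivAt_gambierQ (hu : IsHastingsMcLeod u) {t : ℝ} (ht : u (gambierArg t) ≠ 0) :
    HasDerivAt (gambierQ (-1) u)
      ((2 : ℝ) ^ (1 / 3 : ℝ) * u (gambierArg t) ^ 2 - gambierQ (-1) u t ^ 2 - t / 2) t := by
  have h := (((hu.hasDerivAt_deriv _).comp t (hasDerivAt_gambierArg t)).div
    ((hu.hasDerivAt _).comp t (hasDerivAt_gambierArg t)) ht).const_mul
    (-1 * (2 : ℝ) ^ (-(1 / 3) : ℝ))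
  refine h.congr_deriv ?_
  have hc := two_rpow_neg_third_pow
  have hs : gambierArg t = -(2 : ℝ) ^ (-(1 / 3) : ℝ) * t := rfl
  rw [two_rpow_third_eq, gambierQ]
  simp only [Function.comp]
  generalize (2 : ℝ) ^ (-(1 / 3) : ℝ) = c at *
  generalize gambierArg t = s at *
  field_simp
  subst hs
  linear_combination (-2 * u (-c * t) ^ 2 * t) * hc

theorem gambier_p (hu : IsHastingsMcLeod u) {t : ℝ} (ht : u (gambierArg t) ≠ 0) :
    (gambier (-1) u).p t = (2 : ℝ) ^ (1 / 3 : ℝ) * u (gambierArg t) ^ 2 := by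
  simp only [gambier, (hu.hasDerivAt_gambierQ ht).deriv]
  ring

theorem gambier_solvesOn (hu : IsHastingsMcLeod u) :
    (gambier (-1) u).SolvesOn {t : ℝ | u (gambierArg t) ≠ 0} := by
  intro t ht
  have hp : (gambier (-1) u).p =ᶠ[𝓝 t] fun t => (2 : ℝ) ^ (1 / 3 : ℝ) * u (gambierArg t) ^ 2 := by
    filter_upwards [hu.isOpen_ne_zero.mem_nhds ht] with s hs using hu.gambier_p hs
  refine ⟨(hu.hasDerivAt_gambierQ ht).congr_deriv (by rw [hu.gambier_p ht]; rfl), ?_⟩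
  refine HasDerivAt.congr_of_eventuallyEq ?_ hp
  refine (((hu.hasDerivAt_sq _).comp t (hasDerivAt_gambierArg t)).const_mul _).congr_deriv ?_
  have ht' : u (gambierArg t) ≠ 0 := ht
  rw [hu.gambier_p ht]
  simp only [gambier, gambierQ]
  field_simp
  ring

theorem gambier_p_ne_zero (hu : IsHastingsMcLeod u) {t : ℝ} (ht : u (gambierArg t) ≠ 0) :
    (gambier (-1) u).p t ≠ 0 := by
  rw [hu.gambier_p ht]
  positivity

/-- Since α₁ = 0, the first shift gives p₁ = t - p₀ + 2q₀², in which the energy appears. The second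
shift is therefore possible because h > 0. -/
theorem gambier_T₂_p (hu : IsHastingsMcLeod u) {t : ℝ} (ht : u (gambierArg t) ≠ 0) :
    (gambier (-1) u).T₂.p t =
      (2 : ℝ) ^ (1 / 3 : ℝ) * (piiEnergy u (gambierArg t) / u (gambierArg t) ^ 2) := by
  simp only [PIIState.T₂, hu.gambier_p ht]
  have hc := two_rpow_neg_third_pow
  have hs : gambierArg t = -(2 : ℝ) ^ (-(1 / 3) : ℝ) * t := rfl
  simp only [gambier, gambierQ, piiEnergy]
  rw [two_rpow_third_eq]
  generalize (2 : ℝ) ^ (-(1 / 3) : ℝ) = c at *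
  generalize gambierArg t = s at *
  norm_num
  field_simp
  subst hs
  linear_combination (-2 * u (-c * t) ^ 2 * t) * hc

theorem gambier_T₂_p_ne_zero (hu : IsHastingsMcLeod u) {t : ℝ} (ht : u (gambierArg t) ≠ 0) :
    (gambier (-1) u).T₂.p t ≠ 0 := by
  rw [hu.gambier_T₂_p ht]
  have := (hu.piiEnergy_pos (gambierArg t)).ne'
  positivity

/-- Each shift subtracts the new q, so H₂ = H₀ - q₁ - q₂. With q₂ = -q₁ - 1/p₁ and H₀ = -p₀p₁/2 this
collapses to 1/p₁ - p₀p₁/2. -/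
theorem gambierSigma_eq (hu : IsHastingsMcLeod u) {t : ℝ} (ht : u (gambierArg t) ≠ 0) :
    gambierSigma u t = (gambier (-1) u).T₂.T₂.H t := by
  have h0 : (gambier (-1) u).H t = -(1 / 2) * (gambier (-1) u).T₂.p t * (gambier (-1) u).p t := by
    have hα : (gambier (-1) u).α₁ = 0 := by norm_num [gambier]
    simp only [PIIState.H, PIIState.T₂, hα]
    ring
  have h1 : (gambier (-1) u).T₂.T₂.q t = -(gambier (-1) u).T₂.q t - 1 / (gambier (-1) u).T₂.p t := by
    simp only [PIIState.T₂, gambier]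
    norm_num
  rw [PIIState.H_T₂ _ (hu.gambier_T₂_p_ne_zero ht), PIIState.H_T₂ _ (hu.gambier_p_ne_zero ht), h1,
    h0, hu.gambier_T₂_p ht, hu.gambier_p ht, gambierSigma, two_rpow_third_eq]
  have hc := two_rpow_neg_third_pow
  have := (hu.piiEnergy_pos (gambierArg t)).ne'
  have hc0 : (2 : ℝ) ^ (-(1 / 3) : ℝ) ≠ 0 := by positivity
  generalize (2 : ℝ) ^ (-(1 / 3) : ℝ) = c at *
  generalize gambierArg t = s at *
  field_simp
  linear_combination (2 * u s ^ 2 + 4 * c ^ 3 * piiEnergy u s ^ 2) * hc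

/-! ### The extended Hamiltonian: smoothness, σ-form and boundary condition. -/

theorem contDiff_piiEnergy (hu : IsHastingsMcLeod u) : ContDiff ℝ 2 (piiEnergy u) := by
  rw [show (2 : WithTop ℕ∞) = 1 + 1 by norm_num, contDiff_succ_iff_deriv]
  refine ⟨fun s => (hu.hasDerivAt_piiEnergy s).differentiableAt, by simp, ?_⟩
  rw [show deriv (piiEnergy u) = fun s => -u s ^ 2 from
    funext fun s => (hu.hasDerivAt_piiEnergy s).deriv]
  exact ((hu.contDiff.of_le (by norm_num)).pow 2).neg

theorem contDiff_gambierSigma (hu : IsHastingsMcLeod u) : ContDiff ℝ 2 (gambierSigma u) := by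
  have h := hu.contDiff_piiEnergy.comp contDiff_gambierArg
  exact contDiff_const.mul (((((hu.contDiff.comp contDiff_gambierArg).pow 2)).div h
    fun t => (hu.piiEnergy_pos _).ne').sub h)

theorem hasDerivAt_sq_div_piiEnergy (hu : IsHastingsMcLeod u) (s : ℝ) :
    HasDerivAt (fun s => u s ^ 2 / piiEnergy u s - piiEnergy u s)
      (2 * u s * deriv u s / piiEnergy u s + u s ^ 4 / piiEnergy u s ^ 2 + u s ^ 2) s := by
  have h := (hu.piiEnergy_pos s).ne'
  refine (((hu.hasDerivAt_sq s).div (hu.hasDerivAt_piiEnergy s) h).sub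
    (hu.hasDerivAt_piiEnergy s)).congr_deriv ?_
  field_simp
  ring

theorem hasDerivAt_deriv_sq_div_piiEnergy (hu : IsHastingsMcLeod u) (s : ℝ) :
    HasDerivAt
      (fun s => 2 * u s * deriv u s / piiEnergy u s + u s ^ 4 / piiEnergy u s ^ 2 + u s ^ 2)
      ((2 * deriv u s ^ 2 + 2 * s * u s ^ 2 + 4 * u s ^ 4) / piiEnergy u s
        + 6 * u s ^ 3 * deriv u s / piiEnergy u s ^ 2 + 2 * u s ^ 6 / piiEnergy u s ^ 3
        + 2 * u s * deriv u s) s := by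
  have h := (hu.piiEnergy_pos s).ne'
  refine ((((hu.hasDerivAt_deriv_sq s).div (hu.hasDerivAt_piiEnergy s) h).add
    (((hu.hasDerivAt s).pow 4).div ((hu.hasDerivAt_piiEnergy s).pow 2) (pow_ne_zero 2 h))).add
    (hu.hasDerivAt_sq s)).congr_deriv ?_
  simp only [Pi.pow_apply]
  field_simp
  ring

theorem deriv_gambierSigma (hu : IsHastingsMcLeod u) :
    deriv (gambierSigma u) = fun t => -((2 : ℝ) ^ (-(1 / 3) : ℝ)) ^ 2 *
      (2 * u (gambierArg t) * deriv u (gambierArg t) / piiEnergy u (gambierArg t)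
        + u (gambierArg t) ^ 4 / piiEnergy u (gambierArg t) ^ 2 + u (gambierArg t) ^ 2) := by
  ext t
  refine (HasDerivAt.deriv (((hu.hasDerivAt_sq_div_piiEnergy _).comp t
    (hasDerivAt_gambierArg t)).const_mul ((2 : ℝ) ^ (-(1 / 3) : ℝ)))).trans ?_
  ring

theorem deriv_deriv_gambierSigma (hu : IsHastingsMcLeod u) (t : ℝ) :
    deriv (deriv (gambierSigma u)) t = ((2 : ℝ) ^ (-(1 / 3) : ℝ)) ^ 3 *
      ((2 * deriv u (gambierArg t) ^ 2 + 2 * gambierArg t * u (gambierArg t) ^ 2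
          + 4 * u (gambierArg t) ^ 4) / piiEnergy u (gambierArg t)
        + 6 * u (gambierArg t) ^ 3 * deriv u (gambierArg t) / piiEnergy u (gambierArg t) ^ 2
        + 2 * u (gambierArg t) ^ 6 / piiEnergy u (gambierArg t) ^ 3
        + 2 * u (gambierArg t) * deriv u (gambierArg t)) := by
  rw [hu.deriv_gambierSigma]
  refine (HasDerivAt.deriv (((hu.hasDerivAt_deriv_sq_div_piiEnergy _).comp t
    (hasDerivAt_gambierArg t)).const_mul (-((2 : ℝ) ^ (-(1 / 3) : ℝ)) ^ 2))).trans ?_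
  ring

theorem isSigmaPII_gambierSigma (hu : IsHastingsMcLeod u) : IsSigmaPII 2 (gambierSigma u) := by
  refine ⟨hu.contDiff_gambierSigma, fun t => ?_⟩
  rw [hu.deriv_deriv_gambierSigma, hu.deriv_gambierSigma, gambierSigma]
  beta_reduce
  have hc := two_rpow_neg_third_pow
  have hs : gambierArg t = -(2 : ℝ) ^ (-(1 / 3) : ℝ) * t := rfl
  have hh := (hu.piiEnergy_pos (gambierArg t)).ne'
  have hE : piiEnergy u (gambierArg t) = deriv u (gambierArg t) ^ 2
    - gambierArg t * u (gambierArg t) ^ 2 - u (gambierArg t) ^ 4 := rfl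
  have hc0 : (2 : ℝ) ^ (-(1 / 3) : ℝ) ≠ 0 := by positivity
  generalize (2 : ℝ) ^ (-(1 / 3) : ℝ) = c at *
  generalize gambierArg t = s at *
  generalize deriv u s = v at *
  generalize piiEnergy u s = h at *
  generalize u s = w at *
  have ht : t = -2 * c ^ 2 * s := by rw [hs]; linear_combination (-2 * t) * hc
  subst ht
  have hv : v ^ 2 = h + s * w ^ 2 + w ^ 4 := by rw [hE]; ring
  clear hE hs
  -- Eliminating v² here makes the second derivative linear in v = u'.
  have key : (2 * v ^ 2 + 2 * s * w ^ 2 + 4 * w ^ 4) / h = (2 * h + 4 * s * w ^ 2 + 6 * w ^ 4) / h := by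
    rw [hv]; ring
  rw [key]
  have hc6 : c ^ 6 = 1 / 4 := by rw [show c ^ 6 = (c ^ 3) ^ 2 by ring, hc]; norm_num
  have main : ((2 * h + 4 * s * w ^ 2 + 6 * w ^ 4) / h + 6 * w ^ 3 * v / h ^ 2 + 2 * w ^ 6 / h ^ 3
        + 2 * w * v) ^ 2 / 4 - (2 * w * v / h + w ^ 4 / h ^ 2 + w ^ 2) ^ 3
      - s * (2 * w * v / h + w ^ 4 / h ^ 2 + w ^ 2) ^ 2
      + (2 * w * v / h + w ^ 4 / h ^ 2 + w ^ 2) * (w ^ 2 / h - h) - 1 = 0 := by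
    -- The cofactor q is the quotient of the left side, as a polynomial in v, by v² - (h + s w² +
    -- w⁴).
    set q := (3 * w ^ 3 / h ^ 2 + w) ^ 2 - 8 * w ^ 3 * v / h ^ 3
      - 12 * w ^ 2 * (w ^ 4 / h ^ 2 + w ^ 2) / h ^ 2 - 4 * s * w ^ 2 / h ^ 2 with hq
    rw [← sub_eq_zero] at hv
    rw [← mul_zero q, ← hv, hq]
    field_simp
    ring
  generalize (2 * h + 4 * s * w ^ 2 + 6 * w ^ 4) / h + 6 * w ^ 3 * v / h ^ 2 + 2 * w ^ 6 / h ^ 3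
    + 2 * w * v = X at *
  generalize 2 * w * v / h + w ^ 4 / h ^ 2 + w ^ 2 = Y at *
  generalize w ^ 2 / h - h = Z at *
  linear_combination main + (X ^ 2 - 4 * Y ^ 3 - 4 * s * Y ^ 2) * hc6 + 2 * Y * Z * hc

theorem gambierSigma_isLittleO (hu : IsHastingsMcLeod u) :
    (fun y : ℝ => gambierSigma u (-y) - (√(2 * y) + 1 / y)) =o[atTop] (fun y : ℝ => 1 / y) := by
  refine isLittleO_iff.2 fun ε hε => ?_
  have hc := two_rpow_neg_third_pow
  have hc0 : 0 < (2 : ℝ) ^ (-(1 / 3) : ℝ) := by positivity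
  have hs : ∀ y, gambierArg (-y) = (2 : ℝ) ^ (-(1 / 3) : ℝ) * y := fun y => by
    rw [gambierArg]; ring
  have hlim : Tendsto (fun y => gambierArg (-y)) atTop atTop := by
    simp only [hs]
    exact tendsto_id.const_mul_atTop hc0
  filter_upwards [hlim.eventually (hu.eventually_abs_sub_le hε), eventually_gt_atTop 0] with y h hy
  rw [gambierSigma]
  rw [hs] at h ⊢
  generalize (2 : ℝ) ^ (-(1 / 3) : ℝ) = c at *
  -- As 4c³ = 2, the rescaling s = c y turns c(2√s + 1/s) into √(2y) + 1/y exactly.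
  have h1 : √(2 * y) = c * (2 * √(c * y)) := by
    rw [Real.sqrt_eq_iff_mul_self_eq (by positivity) (by positivity)]
    have := Real.mul_self_sqrt (by positivity : 0 ≤ c * y)
    linear_combination -(4 * c ^ 2) * this - (4 * y) * hc
  have h2 : 1 / y = c * (1 / (c * y)) := by field_simp
  rw [h1, h2, Real.norm_eq_abs, Real.norm_eq_abs, ← mul_add, ← mul_sub, abs_mul, abs_mul,
    abs_of_pos hc0, abs_of_pos (by positivity : 0 < 1 / (c * y))]
  calc _ ≤ c * (ε / (c * y)) := mul_le_mul_of_nonneg_left h hc0.le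
    _ = _ := by ring

end IsHastingsMcLeod

theorem mainTheorem6 (u : ℝ → ℝ) (hu : IsHastingsMcLeod u)
    (x₀ x₁ x₂ : PIIState) (hx₀ : x₀ = gambier (-1) u) (hx₁ : x₁ = x₀.T₂) (hx₂ : x₂ = x₁.T₂)
    (D : Set ℝ) (hD : D = {t : ℝ | u (gambierArg t) ≠ 0}) :
    (∀ a : ℝ, {s : ℝ | a ≤ s ∧ u s = 0}.Finite) ∧
    x₀.α₁ = 0 ∧ x₁.α₁ = 1 ∧ x₂.α₁ = 2 ∧
    (∀ t ∈ D, (2 : ℝ) ^ (1 / 3 : ℝ) * u (gambierArg t) ^ 2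
      = deriv x₀.q t + x₀.q t ^ 2 + t / 2) ∧
    (∀ t ∈ D, x₀.p t ≠ 0 ∧ x₁.p t ≠ 0) ∧
    x₀.SolvesOn D ∧ x₁.SolvesOn D ∧ x₂.SolvesOn D ∧
    (∀ t ∈ D, HasDerivAt (deriv x₂.q) (2 * x₂.q t ^ 3 + t * x₂.q t + 3 / 2) t) ∧
    ∃ H : ℝ → ℝ,
      (∀ t ∈ D, H t = x₂.H t) ∧
      IsSigmaPII 2 H ∧
      (fun y : ℝ => H (-y) - (√(2 * y) + 1 / y)) =o[atTop] (fun y : ℝ => 1 / y) := by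
  subst hx₂ hx₁ hx₀ hD
  have h1 := hu.gambier_solvesOn.T₂ fun t ht => hu.gambier_p_ne_zero ht
  have h2 := h1.T₂ fun t ht => hu.gambier_T₂_p_ne_zero ht
  have hα : (gambier (-1) u).T₂.T₂.α₁ = 2 := by norm_num [gambier, PIIState.T₂]
  refine ⟨hu.finite_zeros, by norm_num [gambier], by norm_num [gambier, PIIState.T₂], hα,
    fun t ht => (hu.gambier_p ht).symm,
    fun t ht => ⟨hu.gambier_p_ne_zero ht, hu.gambier_T₂_p_ne_zero ht⟩,
    hu.gambier_solvesOn, h1, h2, fun t ht => ?_,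
    gambierSigma u, fun t ht => hu.gambierSigma_eq ht, hu.isSigmaPII_gambierSigma,
    hu.gambierSigma_isLittleO⟩
  refine (h2.hasDerivAt_deriv_q hu.isOpen_ne_zero ht).congr_deriv ?_
  rw [hα]
  norm_num
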